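/- A graceful difference labeling (gdl) of a finite directed graph $G=(V,A)$ is a bijection $f:V\to\{1,\ldots,|V|\}$ such that the difference labels $f(v)-f(u)$ of the arcs $uv\in A$ are pairwise distinct; the magnitude of the arc $uv$ is $|f(v)-f(u)|$. Let $\overrightarrow{C_3}$ be the directed cycle on three vertices, and let $n\overrightarrow{C_3}$ be the disjoint union of $n$ copies of it. Then: 1. For every $n\ge 2$, the graph $n\overrightarrow{C_3}$ has a gdl in which at most one arc has magnitude $3n-2$ and all other arcs have magnitude strictly smaller than $3n-2$. 2. $\overrightarrow{C_3}$ has no gdl. 3. Consequently, for every $n\ge 1$, the graph $n\overrightarrow{C_3}$ has a gdl if and only if $n\ge 2$. -/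

import Mathlib

namespace Digraph

/-- The circuit (directed cycle) on `k` vertices: vertices `0, …, k - 1`, with an arc from each
vertex to the next one and an arc from the last vertex back to the first. -/
def circuit (k : ℕ) : Digraph (Fin k) where
  Adj i j := (j : ℕ) = ((i : ℕ) + 1) % k

/-- The disjoint union of `n` copies of `G`; the vertex `(i, v)` is the vertex `v` of the `i`-th
copy. -/
def copies {V : Type*} (n : ℕ) (G : Digraph V) : Digraph (Fin n × V) where
  Adj x y := x.1 = y.1 ∧ G.Adj x.2 y.2

/-- The set of arcs of a directed graph, an arc being the ordered pair of its endpoints. -/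
def arcs {V : Type*} (G : Digraph V) : Set (V × V) :=
  {e | G.Adj e.1 e.2}

/-- The difference label `f v - f u` of the arc `(u, v)`. -/
def diffLabel {V : Type*} (f : V → ℕ) (e : V × V) : ℤ :=
  (f e.2 : ℤ) - (f e.1 : ℤ)

/-- The magnitude `|f v - f u|` of the arc `(u, v)`. -/
def magnitude {V : Type*} (f : V → ℕ) (e : V × V) : ℤ :=
  |diffLabel f e|

/-- `f` is a graceful difference labeling of `G`: a bijection from the vertices onto
`{1, …, |V|}` for which distinct arcs have distinct difference labels. -/
def IsGDL {V : Type*} [Fintype V] (G : Digraph V) (f : V → ℕ) : Prop :=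
  Set.BijOn f Set.univ (Set.Icc 1 (Fintype.card V)) ∧ Set.InjOn (diffLabel f) G.arcs

/-- `G` has a graceful difference labeling. -/
def HasGDL {V : Type*} [Fintype V] (G : Digraph V) : Prop :=
  ∃ f : V → ℕ, G.IsGDL f

end Digraph

namespace Digraph

/-! A gdl is written down explicitly as `n` triples, with one formula for each residue of `n` modulo
4. The index range splits into blocks on which entries, and hence labels, are affine in the index; a
few exceptional triples may be added. Every condition is then linear integer arithmetic, left to
`omega`. The construction gives magnitudes strictly below `3 * n - 2` throughout. Surjectivity onto
`{1, …, 3 * n}` is not checked on the formulas: it follows from injectivity by counting. For one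
circuit, 1, 2, 3 in cyclic order always repeat a label. -/

/-- The first `n` terms of `u`, `v` and `w` are `3 * n` distinct integers. -/
def JointlyInjective (n : ℤ) (u v w : ℤ → ℤ) : Prop :=
  ∀ i j : ℤ, 0 ≤ i → i < n → 0 ≤ j → j < n →
    (u i = u j → i = j) ∧ (v i = v j → i = j) ∧ (w i = w j → i = j) ∧
      u i ≠ v j ∧ v i ≠ w j ∧ w i ≠ u j

/-- The triples `t i`, for `0 ≤ i < n`, partition `{1, …, 3 * n}`, the cyclic differences inside
them are pairwise distinct, and all these differences are less than `3 * n - 2` in absolute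
value. -/
structure IsTripleSystem (n : ℤ) (t : ℤ → ℤ × ℤ × ℤ) : Prop where
  mem_Icc : ∀ i, 0 ≤ i → i < n →
    (1 ≤ (t i).1 ∧ (t i).1 ≤ 3 * n) ∧ (1 ≤ (t i).2.1 ∧ (t i).2.1 ≤ 3 * n) ∧
      (1 ≤ (t i).2.2 ∧ (t i).2.2 ≤ 3 * n)
  values : JointlyInjective n (fun i => (t i).1) (fun i => (t i).2.1) (fun i => (t i).2.2)
  labels : JointlyInjective n (fun i => (t i).2.1 - (t i).1) (fun i => (t i).2.2 - (t i).2.1)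
    (fun i => (t i).1 - (t i).2.2)
  bound : ∀ i, 0 ≤ i → i < n →
    |(t i).2.1 - (t i).1| < 3 * n - 2 ∧ |(t i).2.2 - (t i).2.1| < 3 * n - 2 ∧
      |(t i).1 - (t i).2.2| < 3 * n - 2

/-- Triples forming a triple system for `n = 4 * m`. -/
def tripleZero (m i : ℤ) : ℤ × ℤ × ℤ :=
  if i < m then (i + 1, 3 * m + 2 * i + 1, 6 * m - i)
  else if i < 2 * m then (i + 1, 5 * m + 2 * i + 2, 11 * m - i)
  else if i < 3 * m then (i + 1, 13 * m - i, 9 * m - 2 * i)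
  else (3 * m + i + 1, 15 * m - i, 15 * m - 2 * i - 1)

/-- Triples forming a triple system for `n = 4 * m + 1`. -/
def tripleOne (m i : ℤ) : ℤ × ℤ × ℤ :=
  if i < m then (i + 1, 7 * m + 2 * i + 3, 10 * m - i + 2)
  else if i < 2 * m then (i + 1, 8 * m - i + 1, 5 * m + 2 * i + 2)
  else if i < 3 * m then (i + 1, 14 * m - i + 2, 9 * m - 2 * i - 1)
  else if i < 4 * m then (-3 * m + 2 * i + 2, 7 * m + i + 3, 9 * m - i + 1)
  else (5 * m + 1, 9 * m + 2, 12 * m + 3)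

/-- Triples forming a triple system for `n = 4 * m + 2`. -/
def tripleTwo (m i : ℤ) : ℤ × ℤ × ℤ :=
  if i < m then (2 * i + 2, 10 * m - i + 5, 8 * m + i + 5)
  else if i < 2 * m then (-2 * m + 2 * i + 3, 6 * m - i + 2, 9 * m + i + 6)
  else if i < 3 * m then (-2 * m + 2 * i + 3, 9 * m - i + 3, 5 * m + i + 5)
  else if i < 4 * m then (-4 * m + 2 * i + 4, 15 * m - i + 5, 2 * m + i + 4)
  else if i = 4 * m then (1, 2 * m + 2, 7 * m + 4)
  else (5 * m + 3, 12 * m + 6, 9 * m + 5)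

/-- Triples forming a triple system for `n = 4 * m + 3`. -/
def tripleThree (m i : ℤ) : ℤ × ℤ × ℤ :=
  if i < m then (i + 1, 8 * m + 2 * i + 9, 11 * m - i + 8)
  else if i < 2 * m then (i + 2, 8 * m - i + 4, 2 * m + 2 * i + 6)
  else if i < 3 * m then (i + 3, 10 * m - i + 6, 4 * m + 2 * i + 10)
  else if i < 4 * m then (i + 3, 12 * m - 2 * i + 3, 15 * m - i + 9)
  else if i = 4 * m then (m + 1, 4 * m + 4, 7 * m + 6)
  else if i = 4 * m + 1 then (2 * m + 2, 8 * m + 7, 8 * m + 8)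
  else (4 * m + 3, 11 * m + 9, 7 * m + 5)

theorem isTripleSystem_tripleZero {m : ℤ} (hm : 1 ≤ m) :
    IsTripleSystem (4 * m) (tripleZero m) where
  mem_Icc i _ _ := by
    simp only [tripleZero]
    split_ifs <;> dsimp only <;> omega
  values i j _ _ _ _ := by
    simp only [tripleZero]
    split_ifs <;> dsimp only <;> omega
  labels i j _ _ _ _ := by
    simp only [tripleZero]
    split_ifs <;> dsimp only <;> omega
  bound i _ _ := by
    simp only [tripleZero, abs_lt]
    split_ifs <;> dsimp only <;> omega

/-- Here `m = 0` must be excluded: the only triple would be `(1, 2, 3)`, with labels 1, 1, -2. -/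
theorem isTripleSystem_tripleOne {m : ℤ} (hm : 1 ≤ m) :
    IsTripleSystem (4 * m + 1) (tripleOne m) where
  mem_Icc i _ _ := by
    simp only [tripleOne]
    split_ifs <;> dsimp only <;> omega
  values i j _ _ _ _ := by
    simp only [tripleOne]
    split_ifs <;> dsimp only <;> omega
  labels i j _ _ _ _ := by
    simp only [tripleOne]
    split_ifs <;> dsimp only <;> omega
  bound i _ _ := by
    simp only [tripleOne, abs_lt]
    split_ifs <;> dsimp only <;> omega

theorem isTripleSystem_tripleTwo {m : ℤ} (hm : 0 ≤ m) :
    IsTripleSystem (4 * m + 2) (tripleTwo m) where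
  mem_Icc i _ _ := by
    simp only [tripleTwo]
    split_ifs <;> dsimp only <;> omega
  values i j _ _ _ _ := by
    simp only [tripleTwo]
    split_ifs <;> dsimp only <;> omega
  labels i j _ _ _ _ := by
    simp only [tripleTwo]
    split_ifs <;> dsimp only <;> omega
  bound i _ _ := by
    simp only [tripleTwo, abs_lt]
    split_ifs <;> dsimp only <;> omega

set_option maxHeartbeats 1000000 in
theorem isTripleSystem_tripleThree {m : ℤ} (hm : 0 ≤ m) :
    IsTripleSystem (4 * m + 3) (tripleThree m) where
  mem_Icc i _ _ := by
    simp only [tripleThree]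
    split_ifs <;> dsimp only <;> omega
  values i j _ _ _ _ := by
    simp only [tripleThree]
    split_ifs <;> dsimp only <;> omega
  labels i j _ _ _ _ := by
    simp only [tripleThree]
    split_ifs <;> dsimp only <;> omega
  bound i _ _ := by
    simp only [tripleThree, abs_lt]
    split_ifs <;> dsimp only <;> omega

theorem exists_isTripleSystem {n : ℤ} (hn : 2 ≤ n) : ∃ t, IsTripleSystem n t := by
  obtain ⟨m, rfl | rfl | rfl | rfl⟩ :
      ∃ m, n = 4 * m ∨ n = 4 * m + 1 ∨ n = 4 * m + 2 ∨ n = 4 * m + 3 := ⟨n / 4, by omega⟩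
  · exact ⟨_, isTripleSystem_tripleZero (by omega)⟩
  · exact ⟨_, isTripleSystem_tripleOne (by omega)⟩
  · exact ⟨_, isTripleSystem_tripleTwo (by omega)⟩
  · exact ⟨_, isTripleSystem_tripleThree (by omega)⟩

/-- The entry of a triple at a given vertex of the circuit on three vertices. -/
def tripleEntry (x : ℤ × ℤ × ℤ) : Fin 3 → ℤ :=
  ![x.1, x.2.1, x.2.2]

theorem JointlyInjective.eq {n : ℕ} {t : ℤ → ℤ × ℤ × ℤ}
    (h : JointlyInjective n (fun i => (t i).1) (fun i => (t i).2.1) (fun i => (t i).2.2))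
    {x y : Fin n × Fin 3}
    (hxy : tripleEntry (t (x.1 : ℕ)) x.2 = tripleEntry (t (y.1 : ℕ)) y.2) : x = y := by
  obtain ⟨⟨i, hi⟩, r⟩ := x
  obtain ⟨⟨j, hj⟩, s⟩ := y
  have hij := h i j (by omega) (by omega) (by omega) (by omega)
  -- `JointlyInjective` compares the sequences only in cyclic order, so the reverse comparisons need
  -- `i` and `j` swapped.
  have hji := h j i (by omega) (by omega) (by omega) (by omega)
  simp only [Nat.cast_inj] at hij hji
  fin_cases r <;> fin_cases s <;>
    simp only [tripleEntry, Fin.mk_zero, Fin.mk_one, Fin.reduceFinMk, Matrix.cons_val,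
      Matrix.cons_val_zero, Matrix.cons_val_one, Prod.mk.injEq, Fin.mk.injEq] at hxy ⊢ <;> grind

theorem circuit_three_adj_iff {r s : Fin 3} : (circuit 3).Adj r s ↔ s = r + 1 := by
  change (s : ℕ) = ((r : ℕ) + 1) % 3 ↔ s = r + 1
  revert r s
  decide

theorem mem_arcs_copies_circuit_three {n : ℕ} {e : (Fin n × Fin 3) × (Fin n × Fin 3)} :
    e ∈ (copies n (circuit 3)).arcs ↔ e.2 = (e.1.1, e.1.2 + 1) := by
  change e.1.1 = e.2.1 ∧ (circuit 3).Adj e.1.2 e.2.2 ↔ _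
  rw [circuit_three_adj_iff, Prod.ext_iff, eq_comm]

/-- Labels become entries of a triple of differences, so `JointlyInjective.eq` serves for labels as
well as values. -/
theorem tripleEntry_add_one_sub (x : ℤ × ℤ × ℤ) (r : Fin 3) :
    tripleEntry x (r + 1) - tripleEntry x r =
      tripleEntry (x.2.1 - x.1, x.2.2 - x.2.1, x.1 - x.2.2) r := by
  fin_cases r <;> rfl

/-- For `n ≥ 2`, the disjoint union of `n` circuits on three vertices has a graceful difference
labeling all of whose magnitudes are less than `3 * n - 2`. -/
theorem exists_isGDL_magnitude_lt {n : ℕ} (hn : 2 ≤ n) :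
    ∃ f : Fin n × Fin 3 → ℕ, (copies n (circuit 3)).IsGDL f ∧
      ∀ e ∈ (copies n (circuit 3)).arcs, magnitude f e < 3 * (n : ℤ) - 2 := by
  obtain ⟨t, ht⟩ := exists_isTripleSystem (n := n) (by omega)
  have hmem (x : Fin n × Fin 3) :
      1 ≤ tripleEntry (t (x.1 : ℕ)) x.2 ∧ tripleEntry (t (x.1 : ℕ)) x.2 ≤ 3 * n := by
    obtain ⟨⟨i, hi⟩, r⟩ := x
    obtain ⟨h₀, h₁, h₂⟩ := ht.mem_Icc i (by omega) (by omega)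
    fin_cases r
    exacts [h₀, h₁, h₂]
  -- `toNat` loses nothing, since all entries are at least 1.
  let f : Fin n × Fin 3 → ℕ := fun x => (tripleEntry (t (x.1 : ℕ)) x.2).toNat
  have hf (x : Fin n × Fin 3) : (f x : ℤ) = tripleEntry (t (x.1 : ℕ)) x.2 :=
    Int.toNat_of_nonneg (by linarith [hmem x])
  have hlabel {e : (Fin n × Fin 3) × (Fin n × Fin 3)} (he : e ∈ (copies n (circuit 3)).arcs) :
      diffLabel f e = tripleEntry ((fun i => ((t i).2.1 - (t i).1, (t i).2.2 - (t i).2.1,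
        (t i).1 - (t i).2.2)) ((e.1.1 : ℕ) : ℤ)) e.1.2 := by
    rw [diffLabel, hf, hf, mem_arcs_copies_circuit_three.1 he, tripleEntry_add_one_sub]
  have hinj : Function.Injective f := fun x y hxy =>
    ht.values.eq (by rw [← hf, ← hf, hxy])
  have hmaps : Set.MapsTo f Set.univ (Set.Icc 1 (Fintype.card (Fin n × Fin 3))) := by
    intro x _
    have h := hmem x
    rw [← hf] at h
    simp only [Fintype.card_prod, Fintype.card_fin, Set.mem_Icc]
    omega
  have himage : Finset.univ.image f = Finset.Icc 1 (Fintype.card (Fin n × Fin 3)) := by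
    refine Finset.eq_of_subset_of_card_le (fun y hy => ?_) ?_
    · obtain ⟨x, -, rfl⟩ := Finset.mem_image.1 hy
      exact Finset.mem_Icc.2 (hmaps (Set.mem_univ x))
    · rw [Finset.card_image_of_injective _ hinj, Nat.card_Icc, Finset.card_univ]
      omega
  refine ⟨f, ⟨⟨hmaps, hinj.injOn, fun y hy => ?_⟩, fun e he e' he' hee' => ?_⟩, fun e he => ?_⟩
  · have hy' : y ∈ Finset.univ.image f := by
      rw [himage]
      exact Finset.mem_Icc.2 hy
    obtain ⟨x, -, rfl⟩ := Finset.mem_image.1 hy'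
    exact Set.mem_image_of_mem f (Set.mem_univ x)
  · rw [hlabel he, hlabel he'] at hee'
    have hfst : e.1 = e'.1 := JointlyInjective.eq (t := fun i =>
      ((t i).2.1 - (t i).1, (t i).2.2 - (t i).2.1, (t i).1 - (t i).2.2)) ht.labels hee'
    -- An arc is determined by its source.
    refine Prod.ext hfst ?_
    rw [mem_arcs_copies_circuit_three.1 he, mem_arcs_copies_circuit_three.1 he', hfst]
  · rw [magnitude, hlabel he]
    obtain ⟨⟨⟨i, hi⟩, r⟩, y⟩ := e
    obtain ⟨h₀, h₁, h₂⟩ := ht.bound i (by omega) (by omega)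
    fin_cases r
    exacts [h₀, h₁, h₂]

/-- Up to rotation the values are 1, 2, 3 or 3, 2, 1, with labels 1, 1, -2 or -1, -1, 2. -/
theorem not_hasGDL_circuit_three : ¬ (circuit 3).HasGDL := by
  rintro ⟨f, hf, hlabel⟩
  have hmem (r : Fin 3) : 1 ≤ f r ∧ f r ≤ 3 := hf.mapsTo (Set.mem_univ r)
  have hne {r s : Fin 3} (hrs : r ≠ s) : f r ≠ f s := fun h =>
    hrs (hf.injOn (Set.mem_univ r) (Set.mem_univ s) h)
  have hdiff {r s : Fin 3} (hrs : r ≠ s) :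
      (f (r + 1) : ℤ) - f r ≠ (f (s + 1) : ℤ) - f s := fun h =>
    hrs (Prod.ext_iff.1 (hlabel (x₁ := (r, r + 1)) (x₂ := (s, s + 1))
      (circuit_three_adj_iff.2 rfl) (circuit_three_adj_iff.2 rfl) h)).1
  have h₀₁ : (f 1 : ℤ) - f 0 ≠ f 2 - f 1 := hdiff (r := 0) (s := 1) (by decide)
  have h₁₂ : (f 2 : ℤ) - f 1 ≠ f 0 - f 2 := hdiff (r := 1) (s := 2) (by decide)
  have h₂₀ : (f 0 : ℤ) - f 2 ≠ f 1 - f 0 := hdiff (r := 2) (s := 0) (by decide)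
  have := hmem 0
  have := hmem 1
  have := hmem 2
  have := hne (r := 0) (s := 1) (by decide)
  have := hne (r := 1) (s := 2) (by decide)
  have := hne (r := 2) (s := 0) (by decide)
  omega

theorem HasGDL.of_copies_one {V : Type*} [Fintype V] {G : Digraph V}
    (h : (copies 1 G).HasGDL) : G.HasGDL := by
  obtain ⟨f, hf, hlabel⟩ := h
  refine ⟨fun v => f (0, v), ⟨fun v _ => ?_, fun v _ w _ hvw => ?_, fun y hy => ?_⟩,
    fun e he e' he' hee' => ?_⟩
  · simpa using hf.mapsTo (Set.mem_univ (0, v))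
  · exact (Prod.ext_iff.1 (hf.injOn (Set.mem_univ (0, v)) (Set.mem_univ (0, w)) hvw)).2
  · obtain ⟨⟨i, v⟩, -, rfl⟩ := hf.surjOn (by simpa using hy)
    exact ⟨v, Set.mem_univ v, by rw [Subsingleton.elim i 0]⟩
  · have := hlabel (x₁ := ((0, e.1), (0, e.2))) (x₂ := ((0, e'.1), (0, e'.2))) ⟨rfl, he⟩ ⟨rfl, he'⟩
      hee'
    simp only [Prod.mk.injEq, true_and] at this
    exact Prod.ext this.1 this.2

end Digraph

theorem lemma7 :
    (∀ n : ℕ, 2 ≤ n →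
      ∃ f : Fin n × Fin 3 → ℕ,
        (Digraph.copies n (Digraph.circuit 3)).IsGDL f ∧
        {e ∈ (Digraph.copies n (Digraph.circuit 3)).arcs |
          Digraph.magnitude f e = 3 * (n : ℤ) - 2}.Subsingleton ∧
        ∀ e ∈ (Digraph.copies n (Digraph.circuit 3)).arcs,
          Digraph.magnitude f e ≠ 3 * (n : ℤ) - 2 →
            Digraph.magnitude f e < 3 * (n : ℤ) - 2) ∧
    ¬ (Digraph.circuit 3).HasGDL ∧
    (∀ n : ℕ, 1 ≤ n → ((Digraph.copies n (Digraph.circuit 3)).HasGDL ↔ 2 ≤ n)) := by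
  refine ⟨fun n hn => ?_, Digraph.not_hasGDL_circuit_three, fun n hn => ⟨fun h => ?_, fun h => ?_⟩⟩
  · obtain ⟨f, hf, hlt⟩ := Digraph.exists_isGDL_magnitude_lt hn
    -- The strict bound makes the set of arcs of magnitude `3 * n - 2` empty.
    exact ⟨f, hf, fun e he => absurd he.2 (hlt e he.1).ne, fun e he _ => hlt e he⟩
  · by_contra hn'
    obtain rfl : n = 1 := by omega
    exact Digraph.not_hasGDL_circuit_three h.of_copies_one
  · obtain ⟨f, hf, -⟩ := Digraph.exists_isGDL_magnitude_lt h
    exact ⟨f, hf⟩
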